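/- Let $\mathbb D=\{z\in\mathbb C:|z|<1\}$ and $\gamma\in\mathbb R$. Let $f=h+\overline g$ be a univalent, sense-preserving (that is, $|h'|^2-|g'|^2>0$ in $\mathbb D$) harmonic function on $\mathbb D$, where $h,g$ are analytic in $\mathbb D$ and $h(0)=g(0)=0$. Suppose that $f$ is a slanted half-plane mapping in the following sense: its values lie in $H_\gamma=\{w:\operatorname{Re}(e^{i\gamma}w)>-1/2\}$, and it is normalized by $h'(0)+e^{-2i\gamma}g'(0)=1$. (Every $f$ with $h'(0)=1$, $g'(0)=0$ and $f(\mathbb D)=H_\gamma$ is of this kind.) Let $f$ have the dilatation $$\omega(z)=\frac{g'(z)}{h'(z)}=\frac{z+a}{1+\overline a z}\quad(z\in\mathbb D),\qquad a=|a|e^{i\theta},\ \theta\in\mathbb R,\ |a|<1 .$$ Suppose that $$|a|^2\left(\cos^2\left(\theta-\tfrac{\gamma}{2}\right)+9\sin^2\left(\theta-\tfrac{\gamma}{2}\right)\right)\le 1$$ and that the two equalities $$|a|\cos\left(\theta-\tfrac{\gamma}{2}\right)=-\cos\tfrac{3\gamma}{2},\qquad 3|a|\sin\left(\theta-\tfrac{\gamma}{2}\right)=-\sin\tfrac{3\gamma}{2}$$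 do not both hold. Let $f_0=h_0+\overline{g_0}$ with $h_0(z)=\dfrac{z-z^2/2}{(1-z)^2}$ and $g_0(z)=\dfrac{-z^2/2}{(1-z)^2}$, and let $F=f_0*f=(h_0*h)+\overline{(g_0*g)}$, where $*$ on the right is the Hadamard (coefficientwise) product of power series at $0$. Let $\mathcal S_H^0$ be the class of univalent, sense-preserving harmonic functions $k=p+\overline q$ on $\mathbb D$, with $p,q$ analytic, $p(0)=q(0)=0$, $p'(0)=1$ and $q'(0)=0$. Then: 1. $F$ is a univalent, sense-preserving harmonic function on $\mathbb D$, and $(1+ae^{-2i\gamma})F\in\mathcal S_H^0$; in particular $F_{\bar z}(0)=0$. 2. If $f\in\mathcal S_H^0$, then $F\in\mathcal S_H^0$. 3. $F$ is convex in the direction $-\gamma$: for every $b\in\mathbb C$ the set $F(\mathbb D)\cap\{b+te^{-i\gamma}:t\in\mathbb R\}$ is connected or empty. -/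

import Mathlib

namespace HarmonicConvolution

/-- The open unit disk. -/
def unitDisk : Set ℂ := Metric.ball 0 1

/-- A complex-valued harmonic function `f = h + conj g` on the unit disk, given by its analytic
part `h` and co-analytic part `g`. Analyticity and `h 0 = g 0 = 0` (which make `h` and `g` unique)
are imposed in `IsUnivalent` below. -/
structure HarmonicPair where
  h : ℂ → ℂ
  g : ℂ → ℂ

namespace HarmonicPair

/-- The function `f(z) = h(z) + conj (g(z))`. -/
noncomputable def eval (f : HarmonicPair) (z : ℂ) : ℂ :=
  f.h z + (starRingEnd ℂ) (f.g z)

/-- The product `c • f` with a complex constant: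
`c (h + conj g) = c h + conj ((conj c) g)`. -/
noncomputable def scale (c : ℂ) (f : HarmonicPair) : HarmonicPair :=
  ⟨fun z => c * f.h z, fun z => (starRingEnd ℂ) c * f.g z⟩

theorem eval_scale (c : ℂ) (f : HarmonicPair) (z : ℂ) :
    (scale c f).eval z = c * f.eval z := by
  simp [scale, eval, mul_add]

/-- The complex dilatation `g' / h'`. -/
noncomputable def dilatation (f : HarmonicPair) (z : ℂ) : ℂ :=
  deriv f.g z / deriv f.h z

/-- `f = h + conj g` is a sense-preserving univalent harmonic function on the unit disk, with
`h` and `g` analytic and vanishing at `0`. Sense-preserving: the Jacobian `|h'|² - |g'|²` is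
positive. -/
structure IsUnivalent (f : HarmonicPair) : Prop where
  analytic_h : DifferentiableOn ℂ f.h unitDisk
  analytic_g : DifferentiableOn ℂ f.g unitDisk
  h_zero : f.h 0 = 0
  g_zero : f.g 0 = 0
  jacobian_pos : ∀ z ∈ unitDisk, 0 < ‖deriv f.h z‖ ^ 2 - ‖deriv f.g z‖ ^ 2
  injOn : Set.InjOn f.eval unitDisk

/-- The class `S_H^0`: sense-preserving univalent harmonic functions with `f(0) = 0`,
`f_z(0) = 1` and `f_{z̄}(0) = 0`. -/
structure MemSH0 (f : HarmonicPair) : Prop extends IsUnivalent f where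
  deriv_h_zero : deriv f.h 0 = 1
  deriv_g_zero : deriv f.g 0 = 0

end HarmonicPair

/-- The slanted half-plane `H_γ = {w : Re (e^{iγ} w) > -1/2}`. -/
noncomputable def slantedHalfPlane (γ : ℝ) : Set ℂ :=
  {w | -(1 / 2 : ℝ) < (Complex.exp (γ * Complex.I) * w).re}

/-- Slanted half-plane harmonic mappings with parameter `γ`: sense-preserving univalent harmonic
`f = h + conj g` with `f(0) = 0`, with values in `H_γ`, normalized by
`h'(0) + e^{-2iγ} g'(0) = 1`. Neither `g'(0) = 0` nor `f(𝔻) = H_γ` is required. -/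
structure IsSlantedHalfPlaneMap (γ : ℝ) (f : HarmonicPair) : Prop
    extends HarmonicPair.IsUnivalent f where
  mapsTo : Set.MapsTo f.eval unitDisk (slantedHalfPlane γ)
  normalized :
    deriv f.h 0 + Complex.exp (-(2 * γ * Complex.I)) * deriv f.g 0 = 1

/-- Members of `S_H^0` that map the disk onto `H_γ` are slanted half-plane mappings. -/
theorem IsSlantedHalfPlaneMap.of_onto {γ : ℝ} {f : HarmonicPair} (hf : f.MemSH0)
    (honto : f.eval '' unitDisk = slantedHalfPlane γ) : IsSlantedHalfPlaneMap γ f where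
  toIsUnivalent := hf.toIsUnivalent
  mapsTo := fun z hz => honto ▸ Set.mem_image_of_mem f.eval hz
  normalized := by rw [hf.deriv_h_zero, hf.deriv_g_zero]; simp

/-- The `n`-th Taylor coefficient at `0`. -/
noncomputable def taylorCoeff (F : ℂ → ℂ) (n : ℕ) : ℂ :=
  iteratedDeriv n F 0 / (n.factorial : ℂ)

/-- The Hadamard product `∑ aₙ bₙ zⁿ` of two functions analytic in the unit disk. -/
noncomputable def hadamard (F G : ℂ → ℂ) (z : ℂ) : ℂ :=
  ∑' n : ℕ, taylorCoeff F n * taylorCoeff G n * z ^ n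

/-- The harmonic convolution
`(h₁ + conj g₁) * (h₂ + conj g₂) = (h₁ * h₂) + conj (g₁ * g₂)`. -/
noncomputable def convolution (f₁ f₂ : HarmonicPair) : HarmonicPair :=
  ⟨hadamard f₁.h f₂.h, hadamard f₁.g f₂.g⟩

/-- The harmonic right half-plane mapping `f₀ = h₀ + conj g₀`. -/
noncomputable def f₀ : HarmonicPair :=
  ⟨fun z => (z - z ^ 2 / 2) / (1 - z) ^ 2, fun z => (-z ^ 2 / 2) / (1 - z) ^ 2⟩

/-- `Ω` is convex in the direction `α`: its intersection with every line parallel to `e^{iα}` is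
connected or empty. -/
def ConvexInDirection (α : ℝ) (Ω : Set ℂ) : Prop :=
  ∀ a : ℂ, IsPreconnected
    (Ω ∩ {w | ∃ t : ℝ, w = a + t * Complex.exp (α * Complex.I)})

end HarmonicConvolution

namespace HarmonicConvolution

open Filter Topology

/-! Write e = e^{iγ}. The function φ = e h + ē g has Re φ = Re(e f) > -1/2, φ(0) = 0 and φ'(0) = e,
so the equality case of the Schwarz lemma forces φ = ez/(1-ez) (`eq_div_of_mapsTo_halfPlane`).
Together with g' = ωh' this gives h' and g' explicitly. Convolution with `f₀` is a differential
operator: F has parts H = (h + zh')/2 and G = (g - zg')/2.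

Local univalence: the dilatation G'/H' has modulus |z p/p*|, with p a quadratic polynomial and p*
its reciprocal. A Schur–Cohn estimate gives |p| < |p*| on the disk. With B = a e^{-iγ/2} and Z = 2B
- conj B, the inequality on a says |Z| ≤ 1, and the excluded pair of equalities says Z = -e^{3iγ/2}
(`norm_numerator_lt`).

Global univalence and convexity come from a shear in the variable w = ez/(1-ez), Re w > -1/2. There
eF = K + conj L with Re(K' - L') ≥ Re w + 1/2. This bound makes each level set of Im(K - L) = Im(eF)
a graph over the whole interval (-1/2, ∞) of values of Re w, and Re(eF) increases strictly along
that graph. Hence eF is injective and horizontal slices of its image are connected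
(`injOn_and_isPreconnected_of_shear`). -/

/-! ### Shearing on a half-plane. -/

/-- Implicit function theorem for a level set of `Im Ψ`, solved for the imaginary coordinate. -/
theorem exists_local_level_curve {Ψ : ℂ → ℂ} {d : ℂ} {x y : ℝ}
    (h : HasStrictDerivAt Ψ d (x + y * Complex.I)) (hd : d.re ≠ 0) :
    ∃ (ψ : ℝ → ℝ) (ψ' : ℝ), HasDerivAt ψ ψ' x ∧ ψ x = y ∧
      ∀ᶠ u : ℝ in 𝓝 x, (Ψ (u + ψ u * Complex.I)).im = (Ψ (x + y * Complex.I)).im := by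
  have hA := Complex.equivRealProdCLM.symm.toContinuousLinearMap.hasStrictFDerivAt (x := (x, y))
  have hB : HasStrictFDerivAt Ψ
      ((ContinuousLinearMap.toSpanSingleton ℂ d).restrictScalars ℝ) (Complex.equivRealProdCLM.symm (x, y)) := by
    rw [Complex.equivRealProdCLM_symm_apply]
    exact h.hasStrictFDerivAt.restrictScalars ℝ
  have hf := (Complex.imCLM.hasStrictFDerivAt.comp (x, y) (hB.comp (x, y) hA))
  have hinv : ((Complex.imCLM.comp (((ContinuousLinearMap.toSpanSingleton ℂ d).restrictScalars
      ℝ).comp Complex.equivRealProdCLM.symm.toContinuousLinearMap)).comp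
        (.inr ℝ ℝ ℝ)).IsInvertible := by
    refine ⟨ContinuousLinearEquiv.unitsEquivAut ℝ (Units.mk0 d.re hd), ?_⟩
    ext
    simp [Complex.equivRealProdCLM_symm_apply]
  refine ⟨hf.implicitFunctionOfProdDomain hinv, _,
    (hf.hasStrictFDerivAt_implicitFunctionOfProdDomain hinv).hasFDerivAt.hasDerivAt,
    (hf.eventually_apply_eq_iff_implicitFunctionOfProdDomain hinv).self_of_nhds.mp rfl, ?_⟩
  simpa [Complex.equivRealProdCLM_symm_apply] using
    hf.eventually_apply_implicitFunctionOfProdDomain hinv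

/-- A positivity statement for the derivative of `p + conj q` along a direction `δ` in which it
is real. -/
theorem re_add_conj_pos {k l δ : ℂ} (hlk : ‖l‖ < ‖k‖) (hδ : 0 < δ.re) (hpos : 0 < (k - l).re)
    (him : (k * δ + (starRingEnd ℂ) (l * δ)).im = 0) :
    0 < (k * δ + (starRingEnd ℂ) (l * δ)).re := by
  have hδ0 : δ ≠ 0 := fun h => by simp [h] at hδ
  have h1 : Complex.normSq (l * δ) < Complex.normSq (k * δ) := by
    rw [Complex.normSq_mul, Complex.normSq_mul, Complex.normSq_eq_norm_sq l,
      Complex.normSq_eq_norm_sq k]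
    have := Complex.normSq_pos.2 hδ0
    gcongr
  have h2 : 0 < ((k - l) * δ * (starRingEnd ℂ) δ).re := by
    rw [mul_assoc, Complex.mul_conj]
    simpa using mul_pos hpos (Complex.normSq_pos.2 hδ0)
  have h3 : ((k - l) * δ * (starRingEnd ℂ) δ).re
      = ((k * δ).re - (l * δ).re) * δ.re + ((k * δ).im - (l * δ).im) * δ.im := by
    simp; ring
  have h5 : (k * δ + (starRingEnd ℂ) (l * δ)).im = (k * δ).im - (l * δ).im := by simp; ring
  have h6 : (k * δ + (starRingEnd ℂ) (l * δ)).re = (k * δ).re + (l * δ).re := by simp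
  rw [h5] at him
  -- With equal imaginary parts, X = Re(kδ) and Y = Re(lδ) satisfy X > Y and X² > Y², so X + Y > 0.
  rw [h3, him, zero_mul, add_zero] at h2
  have h4 := pos_of_mul_pos_left h2 hδ.le
  rw [Complex.normSq_apply, Complex.normSq_apply, sub_eq_zero.1 him] at h1
  rw [h6]
  nlinarith

/-- A holomorphic function on a half-plane whose derivative has real part bounded below on
vertical lines maps each vertical line so that the imaginary part is an increasing bijection. -/
theorem strictMono_surjective_im_vertical {Ψ : ℂ → ℂ} {u c : ℝ} (hc : 0 < c)
    (hd : ∀ v : ℝ, DifferentiableAt ℂ Ψ (u + v * Complex.I))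
    (hre : ∀ v : ℝ, c ≤ (deriv Ψ (u + v * Complex.I)).re) :
    StrictMono (fun v : ℝ => (Ψ (u + v * Complex.I)).im) ∧
      Function.Surjective (fun v : ℝ => (Ψ (u + v * Complex.I)).im) := by
  have hder : ∀ v : ℝ, HasDerivAt (fun v : ℝ => (Ψ (u + v * Complex.I)).im)
      (deriv Ψ (u + v * Complex.I)).re v := by
    intro v
    have h1 : HasDerivAt (fun v : ℝ => (u : ℂ) + v * Complex.I) (1 * Complex.I) v :=
      ((HasDerivAt.ofReal_comp (hasDerivAt_id v)).mul_const Complex.I).const_add _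
    have h2 := (hd v).hasDerivAt.comp v h1
    have h3 := Complex.imCLM.hasFDerivAt.comp_hasDerivAt v h2
    simpa [Function.comp_def] using h3
  have hcont : Continuous (fun v : ℝ => (Ψ (u + v * Complex.I)).im) :=
    continuous_iff_continuousAt.2 fun v => (hder v).continuousAt
  -- The v-derivative of Im Ψ is Re Ψ' ≥ c. Subtracting cv leaves a monotone function, which forces
  -- linear growth at both ends and hence surjectivity.
  have hmono : Monotone (fun v : ℝ => (Ψ (u + v * Complex.I)).im - c * v) := by
    have h : ∀ v : ℝ, HasDerivAt (fun v : ℝ => (Ψ (u + v * Complex.I)).im - c * v)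
        ((deriv Ψ (u + v * Complex.I)).re - c * 1) v :=
      fun v => (hder v).sub ((hasDerivAt_id v).const_mul c)
    refine monotone_of_deriv_nonneg (fun v => (h v).differentiableAt) fun v => ?_
    rw [(h v).deriv]
    linarith [hre v]
  refine ⟨strictMono_of_deriv_pos fun v => ?_, hcont.surjective ?_ ?_⟩
  · rw [(hder v).deriv]
    linarith [hre v]
  · refine tendsto_atTop_mono' _ ?_
      (tendsto_atTop_add_const_right _ (Ψ (u + (0 : ℝ) * Complex.I)).im
        (tendsto_id.const_mul_atTop hc))
    filter_upwards [eventually_ge_atTop (0 : ℝ)] with v hv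
    have := hmono hv
    simp only [id] at *
    linarith
  · refine tendsto_atBot_mono' _ ?_
      (tendsto_atBot_add_const_right _ (Ψ (u + (0 : ℝ) * Complex.I)).im
        (tendsto_id.const_mul_atBot hc))
    filter_upwards [eventually_le_atBot (0 : ℝ)] with v hv
    have := hmono hv
    simp only [id] at *
    linarith

/-- A shear criterion on a half-plane: a sense-preserving harmonic function `K + conj L` for which
`Re (K' - L')` is bounded below by the distance to the boundary is univalent and its image is
convex in the direction of the real axis. -/
theorem injOn_and_isPreconnected_of_shear {m : ℝ} {K L : ℂ → ℂ}
    (hK : DifferentiableOn ℂ K {w | m < w.re}) (hL : DifferentiableOn ℂ L {w | m < w.re})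
    (hJ : ∀ w : ℂ, m < w.re → ‖deriv L w‖ < ‖deriv K w‖)
    (hre : ∀ w : ℂ, m < w.re → w.re - m ≤ (deriv K w - deriv L w).re) :
    Set.InjOn (fun w => K w + (starRingEnd ℂ) (L w)) {w | m < w.re} ∧
    ∀ t : ℝ, IsPreconnected
      ((fun w => K w + (starRingEnd ℂ) (L w)) '' {w | m < w.re} ∩ {w | w.im = t}) := by
  set E : ℂ → ℂ := fun w => K w + (starRingEnd ℂ) (L w) with hE
  set Ψ : ℂ → ℂ := fun w => K w - L w with hΨ
  have hopen : IsOpen {w : ℂ | m < w.re} := isOpen_lt continuous_const Complex.continuous_re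
  have hKd : ∀ w : ℂ, m < w.re → DifferentiableAt ℂ K w := fun w hw =>
    hK.differentiableAt (hopen.mem_nhds hw)
  have hLd : ∀ w : ℂ, m < w.re → DifferentiableAt ℂ L w := fun w hw =>
    hL.differentiableAt (hopen.mem_nhds hw)
  have hΨd : ∀ w : ℂ, m < w.re → HasDerivAt Ψ (deriv K w - deriv L w) w := fun w hw =>
    (hKd w hw).hasDerivAt.sub (hLd w hw).hasDerivAt
  have hEim : ∀ w, (E w).im = (Ψ w).im := fun w => by simp [hE, hΨ, sub_eq_add_neg]
  have hvert : ∀ u : ℝ, m < u → StrictMono (fun v : ℝ => (Ψ (u + v * Complex.I)).im) ∧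
      Function.Surjective (fun v : ℝ => (Ψ (u + v * Complex.I)).im) := by
    intro u hu
    have hmem : ∀ v : ℝ, m < ((u : ℂ) + v * Complex.I).re := by simpa using hu
    refine strictMono_surjective_im_vertical (sub_pos.2 hu)
      (fun v => (hΨd _ (hmem v)).differentiableAt) fun v => ?_
    rw [(hΨd _ (hmem v)).deriv]
    simpa using hre _ (hmem v)
  have hlevel : ∀ t : ℝ, ∃ V : ℝ → ℝ, ∀ u, m < u → (Ψ (u + V u * Complex.I)).im = t := by
    intro t
    -- The value 0 for u ≤ m is a dummy; only u > m is ever used.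
    refine ⟨fun u => if hu : m < u then ((hvert u hu).2 t).choose else 0, fun u hu => ?_⟩
    simpa [hu] using ((hvert u hu).2 t).choose_spec
  choose V hV using hlevel
  have hVuniq : ∀ w : ℂ, m < w.re → w = w.re + V (E w).im w.re * Complex.I := by
    intro w hw
    have h1 : (Ψ (w.re + V (E w).im w.re * Complex.I)).im = (Ψ (w.re + w.im * Complex.I)).im := by
      rw [hV _ _ hw, Complex.re_add_im, hEim]
    rw [(hvert _ hw).1.injective h1, Complex.re_add_im]
  have hcurve : ∀ t u : ℝ, m < u → ∃ e : ℝ, 0 < e ∧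
      HasDerivAt (fun x : ℝ => E (x + V t x * Complex.I)) (e : ℂ) u := by
    intro t u hu
    have hmem : m < ((u : ℂ) + V t u * Complex.I).re := by simpa using hu
    have hpos : 0 < (deriv K (u + V t u * Complex.I) - deriv L (u + V t u * Complex.I)).re := by
      have := hre _ hmem
      simp only [Complex.add_re, Complex.ofReal_re, Complex.re_ofReal_mul, Complex.I_re,
        mul_zero, add_zero] at this
      simp only [Complex.add_re, Complex.sub_re] at *
      linarith
    have hΨan : AnalyticAt ℂ Ψ (u + V t u * Complex.I) :=
      (hK.sub hL).analyticAt (hopen.mem_nhds hmem)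
    have hstrict : HasStrictDerivAt Ψ
        (deriv K (u + V t u * Complex.I) - deriv L (u + V t u * Complex.I))
        (u + V t u * Complex.I) := by
      rw [← (hΨd _ hmem).deriv]
      exact hΨan.hasStrictDerivAt
    obtain ⟨ψ, ψ', hψ, hψu, hψlev⟩ := exists_local_level_curve hstrict hpos.ne'
    -- `V t` was obtained by choice; uniqueness on vertical lines identifies it locally with the
    -- implicit function, which makes it differentiable.
    have hVψ : V t =ᶠ[𝓝 u] ψ := by
      filter_upwards [hψlev, lt_mem_nhds hu] with x hx hmx
      apply (hvert x hmx).1.injective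
      simp only
      rw [hV t x hmx, hx, hV t u hu]
    have hVd : HasDerivAt (V t) ψ' u := hψ.congr_of_eventuallyEq hVψ
    set δ : ℂ := 1 + ψ' * Complex.I with hδ
    have hc : HasDerivAt (fun x : ℝ => (x : ℂ) + V t x * Complex.I) δ u :=
      (hasDerivAt_id u).ofReal_comp.add (hVd.ofReal_comp.mul_const Complex.I)
    have hKc := (hKd _ hmem).hasDerivAt.comp u hc
    have hLc := ((hLd _ hmem).hasDerivAt.comp u hc).star
    have hEc : HasDerivAt (fun x : ℝ => E (x + V t x * Complex.I))
      (deriv K (u + V t u * Complex.I) * δ +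
        (starRingEnd ℂ) (deriv L (u + V t u * Complex.I) * δ)) u := hKc.add hLc
    have him : (deriv K (u + V t u * Complex.I) * δ +
        (starRingEnd ℂ) (deriv L (u + V t u * Complex.I) * δ)).im = 0 := by
      have h1 := Complex.imCLM.hasFDerivAt.comp_hasDerivAt u hEc
      have h2 : HasDerivAt (Complex.imCLM ∘ fun x : ℝ => E (x + V t x * Complex.I)) 0 u := by
        refine (hasDerivAt_const u t).congr_of_eventuallyEq ?_
        filter_upwards [lt_mem_nhds hu] with x hmx
        simp [hEim, hV t x hmx]
      exact h1.unique h2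
    have hδ0 : 0 < δ.re := by simp [hδ]
    refine ⟨_, re_add_conj_pos (hJ _ hmem) hδ0 hpos him, ?_⟩
    convert hEc using 1
    exact Complex.ext (by simp) (by rw [him]; simp)
  have hmono : ∀ t : ℝ, StrictMonoOn (fun x : ℝ => (E (x + V t x * Complex.I)).re)
      (Set.Ioi m) := by
    intro t
    have hd : ∀ u, m < u → ∃ e : ℝ, 0 < e ∧
        HasDerivAt (fun x : ℝ => (E (x + V t x * Complex.I)).re) e u := by
      intro u hu
      obtain ⟨e, he, h⟩ := hcurve t u hu
      exact ⟨e, he, by simpa [Function.comp_def] using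
        Complex.reCLM.hasFDerivAt.comp_hasDerivAt u h⟩
    refine strictMonoOn_of_deriv_pos (convex_Ioi m)
      (fun u hu => ((hd u hu).choose_spec.2).continuousAt.continuousWithinAt) fun u hu => ?_
    rw [interior_Ioi] at hu
    obtain ⟨e, he, h⟩ := hd u hu
    rwa [h.deriv]
  refine ⟨fun w₁ h₁ w₂ h₂ h => ?_, fun t => ?_⟩
  · have e₁ := hVuniq w₁ h₁
    have e₂ := hVuniq w₂ h₂
    change E w₁ = E w₂ at h
    rw [← h] at e₂
    have : w₁.re = w₂.re := by
      apply (hmono (E w₁).im).injOn h₁ h₂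
      simp only
      rw [← e₁, ← e₂, h]
    rw [e₁, e₂, this]
  · have : E '' {w | m < w.re} ∩ {w | w.im = t} =
        (fun x : ℝ => E (x + V t x * Complex.I)) '' Set.Ioi m := by
      ext z
      constructor
      · rintro ⟨⟨w, hw, rfl⟩, ht⟩
        refine ⟨w.re, hw, ?_⟩
        have := hVuniq w hw
        rw [show (E w).im = t from ht] at this
        simp only
        rw [← this]
      · rintro ⟨x, hx, rfl⟩
        exact ⟨⟨_, by simpa using hx, rfl⟩, by simp [hEim, hV t x hx]⟩
    rw [this]
    refine isPreconnected_Ioi.image _ fun u hu => ?_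
    obtain ⟨e, he, h⟩ := hcurve t u hu
    exact h.continuousAt.continuousWithinAt

/-! ### Schur–Cohn estimate for the dilatation of the convolution. -/

/-- Schur–Cohn type estimate comparing a quadratic polynomial with its reciprocal polynomial. -/
theorem norm_quadratic_lt_norm_reciprocal {α β κ z : ℂ} (hκ : ‖κ‖ < ‖α‖)
    (h : ‖α * (starRingEnd ℂ) β - β * (starRingEnd ℂ) κ‖ ≤ ‖α‖ ^ 2 - ‖κ‖ ^ 2) (hz : ‖z‖ < 1) :
    ‖α * z ^ 2 + β * z + κ‖ <
      ‖(starRingEnd ℂ) κ * z ^ 2 + (starRingEnd ℂ) β * z + (starRingEnd ℂ) α‖ := by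
  set M := α * (starRingEnd ℂ) β - β * (starRingEnd ℂ) κ with hM
  have key : ‖(starRingEnd ℂ) κ * z ^ 2 + (starRingEnd ℂ) β * z + (starRingEnd ℂ) α‖ ^ 2 -
      ‖α * z ^ 2 + β * z + κ‖ ^ 2 =
      (1 - ‖z‖ ^ 2) * ((‖α‖ ^ 2 - ‖κ‖ ^ 2) * (1 + ‖z‖ ^ 2) + 2 * (M * z).re) := by
    simp only [hM, ← Complex.normSq_eq_norm_sq, Complex.normSq_apply]
    simp [pow_two]
    ring
  have h1 : -(‖M‖ * ‖z‖) ≤ (M * z).re := by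
    rw [← norm_mul]
    exact (abs_le.1 (Complex.abs_re_le_norm _)).1
  have h0 := norm_nonneg z
  have h2 : ‖M‖ * ‖z‖ ≤ (‖α‖ ^ 2 - ‖κ‖ ^ 2) * ‖z‖ := by gcongr
  have h3 : 0 < ‖α‖ ^ 2 - ‖κ‖ ^ 2 := sub_pos.2 (by gcongr)
  -- Since 2 Re(Mz) ≥ -2(|α|² - |κ|²)|z|, the last factor in `key` is at least this quantity.
  have h4 : 0 < (‖α‖ ^ 2 - ‖κ‖ ^ 2) * (1 - ‖z‖) ^ 2 := mul_pos h3 (pow_pos (by linarith) 2)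
  have h5 : 0 < 1 - ‖z‖ ^ 2 := by nlinarith
  have h6 : 0 < (1 - ‖z‖ ^ 2) *
      ((‖α‖ ^ 2 - ‖κ‖ ^ 2) * (1 + ‖z‖ ^ 2) + 2 * (M * z).re) := by
    apply mul_pos h5
    nlinarith
  exact lt_of_pow_lt_pow_left₀ 2 (norm_nonneg _) (by linarith)

/-- The inequality between the numerators of the derivatives of the co-analytic and the analytic
part of the convolution, in the parameters `ε = e^{iγ/2}` and `B = a e^{-iγ/2}`. -/
theorem norm_numerator_lt {ε B z a e c k : ℂ} (hε : ‖ε‖ = 1) (hB : ‖B‖ < 1)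
    (hZ : ‖2 * B - (starRingEnd ℂ) B‖ ≤ 1) (hne : 2 * B - (starRingEnd ℂ) B ≠ -ε ^ 3)
    (hz : ‖z‖ < 1) (he : e = ε ^ 2) (ha : a = B * ε)
    (hc : c = 1 + (starRingEnd ℂ) ε ^ 4 * a) (hk : k = (starRingEnd ℂ) ε ^ 4 + (starRingEnd ℂ) a) :
    ‖z * ((1 - e * z) * (c + k * z) - (z + a) * (-2 * e * (c + k * z) + k * (1 - e * z)))‖ <
      ‖(2 + 3 * (starRingEnd ℂ) a * z) * (1 - e * z) * (c + k * z) -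
        z * (1 + (starRingEnd ℂ) a * z) * (-2 * e * (c + k * z) + k * (1 - e * z))‖ := by
  have hinv : ε * (starRingEnd ℂ) ε = 1 := by
    rw [Complex.mul_conj, Complex.normSq_eq_norm_sq, hε]; simp
  have hε0 : ε ≠ 0 := by rintro rfl; simp at hε
  have hconj : (starRingEnd ℂ) ε = ε⁻¹ := eq_inv_of_mul_eq_one_right hinv
  set α := 2 * e * k with hα
  set β := e * c + 3 * a * e * k with hβ
  set κ := c + a * (2 * e * c - k) with hκ
  set Z := 2 * B - (starRingEnd ℂ) B with hZd
  set R : ℝ := 2 * ‖(starRingEnd ℂ) ε ^ 3 + (starRingEnd ℂ) Z‖ ^ 2 + (1 - ‖Z‖ ^ 2) with hR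
  have hcα : (starRingEnd ℂ) α =
      2 * (starRingEnd ℂ) ε ^ 2 * (ε ^ 4 + a) := by
    simp [hα, he, hk, map_ofNat]
  have hcβ : (starRingEnd ℂ) β = (starRingEnd ℂ) ε ^ 2 * (1 + ε ^ 4 * (starRingEnd ℂ) a)
      + 3 * (starRingEnd ℂ) a * (starRingEnd ℂ) ε ^ 2 * (ε ^ 4 + a) := by
    simp [hβ, he, hk, hc, map_ofNat]
  have hcκ : (starRingEnd ℂ) κ = (1 + ε ^ 4 * (starRingEnd ℂ) a) + (starRingEnd ℂ) a *
      (2 * (starRingEnd ℂ) ε ^ 2 * (1 + ε ^ 4 * (starRingEnd ℂ) a) - (ε ^ 4 + a)) := by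
    simp [hκ, he, hk, hc, map_ofNat]
  -- Put S = conj(ε)³ + conj(Z). Then |α|² - |κ|² = (1-|B|²)(2|S|² + 1 - |Z|²), while the Schur–Cohn
  -- cross term has modulus (1-|B|²)|2S² - (1-|Z|²)|. The required bound is thus the triangle
  -- inequality.
  have id1 : ‖α‖ ^ 2 - ‖κ‖ ^ 2 = (1 - ‖B‖ ^ 2) * R := by
    apply Complex.ofReal_injective
    simp only [hR, Complex.ofReal_sub, Complex.ofReal_mul, Complex.ofReal_add, Complex.ofReal_pow,
      Complex.ofReal_one, Complex.ofReal_ofNat, ← Complex.mul_conj']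
    rw [hcα, hcκ]
    simp only [hα, hκ, hc, hk, he, hZd, map_add, map_sub, map_mul, map_pow, Complex.conj_conj,
      map_ofNat, map_inv₀, inv_inv, hconj, ha]
    -- With conj ε = ε⁻¹, the identity holds with B and conj B as independent variables.
    generalize (starRingEnd ℂ) B = B'
    field_simp
    ring
  have id2 : α * (starRingEnd ℂ) β - β * (starRingEnd ℂ) κ =
      ε ^ 2 * ((1 - ‖B‖ ^ 2 : ℝ) * (2 * ((starRingEnd ℂ) ε ^ 3 + (starRingEnd ℂ) Z) ^ 2
        - (1 - ‖Z‖ ^ 2 : ℝ))) := by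
    simp only [Complex.ofReal_sub, Complex.ofReal_pow, Complex.ofReal_one, ← Complex.mul_conj']
    rw [hcβ, hcκ]
    simp only [hα, hβ, hc, hk, he, hZd, map_sub, map_mul, Complex.conj_conj,
      map_ofNat, hconj, ha]
    generalize (starRingEnd ℂ) B = B'
    field_simp
    ring
  have hB2 : 0 < 1 - ‖B‖ ^ 2 := by nlinarith [norm_nonneg B]
  have hZ2 : 0 ≤ 1 - ‖Z‖ ^ 2 := by nlinarith [norm_nonneg Z]
  -- The excluded equalities amount to S = 0, so `hne` keeps R positive even when |Z| = 1.
  have hRpos : 0 < R := by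
    have h1 : (starRingEnd ℂ) ε ^ 3 + (starRingEnd ℂ) Z ≠ 0 := by
      intro h
      apply hne
      have := congrArg (starRingEnd ℂ) h
      simp only [map_add, map_pow, Complex.conj_conj, map_zero] at this
      exact eq_neg_of_add_eq_zero_right this
    have := norm_pos_iff.2 h1
    positivity
  have hκα : ‖κ‖ < ‖α‖ := by
    have := mul_pos hB2 hRpos
    exact lt_of_pow_lt_pow_left₀ 2 (norm_nonneg _) (by linarith)
  have hM : ‖α * (starRingEnd ℂ) β - β * (starRingEnd ℂ) κ‖ ≤ ‖α‖ ^ 2 - ‖κ‖ ^ 2 := by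
    rw [id2, id1, norm_mul, norm_mul, norm_pow, hε, one_pow, one_mul, Complex.norm_real,
      Real.norm_of_nonneg hB2.le]
    gcongr
    refine (norm_sub_le _ _).trans (le_of_eq ?_)
    rw [norm_mul, norm_pow, Complex.norm_real, Real.norm_of_nonneg hZ2]
    simp [hR]
  have hlt := norm_quadratic_lt_norm_reciprocal hκα hM hz
  have e1 : (1 - e * z) * (c + k * z) - (z + a) * (-2 * e * (c + k * z) + k * (1 - e * z)) =
      α * z ^ 2 + β * z + κ := by
    simp only [hα, hβ, hκ]; ring
  have e2 : (2 + 3 * (starRingEnd ℂ) a * z) * (1 - e * z) * (c + k * z) -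
        z * (1 + (starRingEnd ℂ) a * z) * (-2 * e * (c + k * z) + k * (1 - e * z)) =
      (starRingEnd ℂ) ε ^ 2 *
        ((starRingEnd ℂ) κ * z ^ 2 + (starRingEnd ℂ) β * z + (starRingEnd ℂ) α) := by
    rw [hcα, hcβ, hcκ]
    simp only [hc, hk, he, map_mul, hconj, ha]
    generalize (starRingEnd ℂ) B = B'
    field_simp
    ring
  rw [e1, e2, norm_mul]
  simp only [norm_mul, norm_pow, RCLike.norm_conj, hε, one_pow, one_mul]
  exact (mul_le_of_le_one_left (norm_nonneg _) hz.le).trans_lt hlt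

/-! ### Hadamard products with the two parts of `f₀`. -/

theorem taylorCoeff_eq_of_hasSum {F : ℂ → ℂ} {b : ℕ → ℂ}
    (h : ∀ z ∈ unitDisk, HasSum (fun n => b n * z ^ n) (F z)) (n : ℕ) :
    taylorCoeff F n = b n := by
  have hp : HasFPowerSeriesOnBall F (FormalMultilinearSeries.ofScalars ℂ b) 0 1 := by
    refine ⟨?_, one_pos, fun {y} hy => ?_⟩
    · refine ENNReal.le_of_forall_nnreal_lt fun r hr => ?_
      apply FormalMultilinearSeries.le_radius_of_summable_norm
      have hr' : ((r : ℝ) : ℂ) ∈ unitDisk := by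
        simpa [unitDisk] using hr
      simpa [FormalMultilinearSeries.ofScalars_norm] using (h _ hr').summable.norm
    · have hy' : y ∈ unitDisk := by
        simpa [unitDisk, enorm, ← NNReal.coe_lt_coe] using hy
      simpa [FormalMultilinearSeries.ofScalars_apply_eq, smul_eq_mul, mul_comm] using h y hy'
  have h1 := hp.hasFPowerSeriesAt
  have h2 := h1.analyticAt.hasFPowerSeriesAt
  have h3 := congrArg (fun p => FormalMultilinearSeries.coeff p n)
    (h2.eq_formalMultilinearSeries h1)
  simpa [FormalMultilinearSeries.coeff_ofScalars, taylorCoeff] using h3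

theorem hasSum_of_forall_eq {u v : ℕ → ℂ} {x : ℂ} (h : HasSum u x) (huv : ∀ n, u n = v n) :
    HasSum v x :=
  funext huv ▸ h

theorem hasSum_taylorCoeff {F : ℂ → ℂ} (hF : DifferentiableOn ℂ F unitDisk) {z : ℂ}
    (hz : z ∈ unitDisk) : HasSum (fun n => taylorCoeff F n * z ^ n) (F z) := by
  refine hasSum_of_forall_eq (Complex.hasSum_taylorSeries_on_ball hF hz) fun n => ?_
  simp only [taylorCoeff, smul_eq_mul, sub_zero]
  ring

theorem hasSum_nat_mul_taylorCoeff {F : ℂ → ℂ} (hF : DifferentiableOn ℂ F unitDisk) {z : ℂ}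
    (hz : z ∈ unitDisk) : HasSum (fun n : ℕ => n * taylorCoeff F n * z ^ n) (z * deriv F z) := by
  have h1 := (hasSum_taylorCoeff (hF.deriv Metric.isOpen_ball) hz).mul_left z
  -- The series of F', multiplied by z, is the target series shifted by one; the missing term n = 0
  -- vanishes.
  refine (hasSum_nat_add_iff' 1).mp ?_
  simp only [Finset.range_one, Finset.sum_singleton, Nat.cast_zero, zero_mul, sub_zero]
  refine hasSum_of_forall_eq h1 fun n => ?_
  have : (n.factorial : ℂ) ≠ 0 := by exact_mod_cast n.factorial_ne_zero
  have h2 : (n : ℂ) + 1 ≠ 0 := by exact_mod_cast n.succ_ne_zero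
  simp only [taylorCoeff, iteratedDeriv_succ', Nat.factorial_succ]
  push_cast
  field_simp
  ring

/-- Taylor coefficients of `(1 / (1 - z) + s z / (1 - z) ^ 2 - 1) / 2`. -/
theorem hasSum_half_plane (s : ℂ) {z : ℂ} (hz : z ∈ unitDisk) :
    HasSum (fun n : ℕ => ((1 + s * n) / 2 - if n = 0 then 1 / 2 else 0) * z ^ n)
      ((1 - z)⁻¹ / 2 + s * (z / (1 - z) ^ 2) / 2 - 1 / 2) := by
  have hz' : ‖z‖ < 1 := by simpa [unitDisk] using hz
  have h1 := (hasSum_geometric_of_norm_lt_one hz').div_const 2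
  have h2 := ((hasSum_coe_mul_geometric_of_norm_lt_one hz').mul_left s).div_const 2
  have h3 := hasSum_ite_eq (0 : ℕ) (1 / 2 : ℂ)
  refine hasSum_of_forall_eq ((h1.add h2).sub h3) fun n => ?_
  split_ifs with h
  · simp [h]
  · ring

/-- For n ≥ 1 the coefficients of G are (1 + sn)/2, and the factor n acts as z d/dz. The constant
term of G is 0, whence the need for F(0) = 0. The cases s = 1 and s = -1 are the two parts of `f₀`.
-/
theorem hadamard_eq_of_half_plane {F G : ℂ → ℂ} {s : ℂ} (hF : DifferentiableOn ℂ F unitDisk)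
    (hF0 : F 0 = 0)
    (hG : ∀ z ∈ unitDisk, G z = (1 - z)⁻¹ / 2 + s * (z / (1 - z) ^ 2) / 2 - 1 / 2) {z : ℂ}
    (hz : z ∈ unitDisk) : hadamard G F z = (F z + s * (z * deriv F z)) / 2 := by
  have hc := taylorCoeff_eq_of_hasSum (F := G) fun z hz => hG z hz ▸ hasSum_half_plane s hz
  refine HasSum.tsum_eq ?_
  refine hasSum_of_forall_eq (((hasSum_taylorCoeff hF hz).add
    ((hasSum_nat_mul_taylorCoeff hF hz).mul_left s)).div_const 2) fun n => ?_
  rw [hc]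
  split_ifs with h
  · simp [h, taylorCoeff, hF0]
  · ring

theorem hadamard_f₀_h {F : ℂ → ℂ} (hF : DifferentiableOn ℂ F unitDisk) (hF0 : F 0 = 0) {z : ℂ}
    (hz : z ∈ unitDisk) : hadamard f₀.h F z = (F z + z * deriv F z) / 2 := by
  rw [hadamard_eq_of_half_plane (s := 1) hF hF0 (fun w hw => ?_) hz, one_mul]
  have : 1 - w ≠ 0 := sub_ne_zero.2 (by rintro rfl; simp [unitDisk] at hw)
  simp only [f₀]
  field_simp
  ring

theorem hadamard_f₀_g {F : ℂ → ℂ} (hF : DifferentiableOn ℂ F unitDisk) (hF0 : F 0 = 0) {z : ℂ}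
    (hz : z ∈ unitDisk) : hadamard f₀.g F z = (F z - z * deriv F z) / 2 := by
  rw [hadamard_eq_of_half_plane (s := -1) hF hF0 (fun w hw => ?_) hz]
  · ring
  have : 1 - w ≠ 0 := sub_ne_zero.2 (by rintro rfl; simp [unitDisk] at hw)
  simp only [f₀]
  field_simp
  ring

/-! ### Rigidity of half-plane maps. -/

/-- Equality case of Carathéodory's coefficient bound: an analytic map of the disk into
`{Re w > -1/2}` with `φ 0 = 0` and `|φ' 0| = 1` is a half-plane map. -/
theorem eq_div_of_mapsTo_halfPlane {φ : ℂ → ℂ} {e : ℂ} (hφ : DifferentiableOn ℂ φ unitDisk)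
    (hφ0 : φ 0 = 0) (hφ' : deriv φ 0 = e) (he : ‖e‖ = 1)
    (hre : ∀ z ∈ unitDisk, -(1 / 2 : ℝ) < (φ z).re) {z : ℂ} (hz : z ∈ unitDisk) :
    φ z = e * z / (1 - e * z) := by
  have hne : ∀ z ∈ unitDisk, 1 + φ z ≠ 0 := fun z hz h => by
    have h1 := hre z hz
    have h2 := congrArg Complex.re h
    simp at h1 h2
    linarith
  -- The map w ↦ w/(1+w) sends {Re w > -1/2} into the unit disk, so s is a Schwarz function with
  -- |s'(0)| = 1, hence s(z) = ez.
  set s : ℂ → ℂ := fun z => φ z / (1 + φ z) with hs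
  have h0 : (0 : ℂ) ∈ unitDisk := by simp [unitDisk]
  have hsd : DifferentiableOn ℂ s unitDisk := hφ.div (hφ.const_add 1) hne
  have hs0 : s 0 = 0 := by simp [hs, hφ0]
  have hd0 : HasDerivAt φ e 0 :=
    hφ' ▸ (hφ.differentiableAt (Metric.isOpen_ball.mem_nhds h0)).hasDerivAt
  have hs' : deriv s 0 = e := by
    have := hd0.div (hd0.const_add 1) (hne 0 h0)
    simpa [hφ0, hs, Pi.div_def] using this.deriv
  have hmaps : Set.MapsTo s (Metric.ball 0 1) (Metric.closedBall (s 0) 1) := by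
    intro w hw
    rw [hs0, mem_closedBall_zero_iff, hs]
    simp only [norm_div]
    have h1 := hre w hw
    refine div_le_one_of_le₀ ?_ (norm_nonneg _)
    refine le_of_sq_le_sq ?_ (norm_nonneg _)
    rw [← Complex.normSq_eq_norm_sq, ← Complex.normSq_eq_norm_sq, Complex.normSq_apply,
      Complex.normSq_apply]
    simp
    nlinarith
  have hsch := Complex.affine_of_mapsTo_ball_of_norm_dslope_eq_div hsd hmaps h0
    (by rw [dslope_same, hs', he]; simp)
  have h1 := hsch hz
  rw [dslope_same, hs', hs0] at h1
  simp only [hs, zero_add, sub_zero, smul_eq_mul] at h1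
  have h2 := hne z hz
  rw [div_eq_iff h2] at h1
  have h3 : 1 - e * z ≠ 0 := by
    intro h
    have : e * z = 1 := (sub_eq_zero.1 h).symm
    have h4 : ‖e * z‖ < 1 := by rw [norm_mul, he, one_mul]; simpa [unitDisk] using hz
    rw [this] at h4
    simp at h4
  rw [eq_div_iff h3]
  linear_combination h1

/-! ### Passage between the disk and the half-plane. -/

theorem isOpen_unitDisk : IsOpen unitDisk := Metric.isOpen_ball

theorem mem_unitDisk {z : ℂ} : z ∈ unitDisk ↔ ‖z‖ < 1 := by simp [unitDisk]

theorem one_add_mul_ne_zero {b z : ℂ} (hb : ‖b‖ ≤ 1) (hz : z ∈ unitDisk) : 1 + b * z ≠ 0 := by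
  intro h
  have h1 : ‖b * z‖ < 1 := by
    rw [norm_mul]
    exact (mul_le_of_le_one_left (norm_nonneg _) hb).trans_lt (mem_unitDisk.1 hz)
  rw [eq_neg_of_add_eq_zero_right h] at h1
  simp at h1

theorem one_sub_mul_ne_zero {b z : ℂ} (hb : ‖b‖ ≤ 1) (hz : z ∈ unitDisk) : 1 - b * z ≠ 0 := by
  simpa [sub_eq_add_neg] using one_add_mul_ne_zero (b := -b) (by simpa using hb) hz

/-- Because |1+w|² - |w|² = 1 + 2 Re w. This puts w/(1+w) in the unit disk. -/
theorem norm_lt_norm_one_add {w : ℂ} (hw : -(1 / 2) < w.re) : ‖w‖ < ‖1 + w‖ := by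
  refine lt_of_pow_lt_pow_left₀ 2 (norm_nonneg _) ?_
  rw [← Complex.normSq_eq_norm_sq, ← Complex.normSq_eq_norm_sq, Complex.normSq_apply,
    Complex.normSq_apply]
  simp
  nlinarith

theorem neg_half_lt_re_div {e z : ℂ} (he : ‖e‖ = 1) (hz : z ∈ unitDisk) :
    -(1 / 2) < (e * z / (1 - e * z)).re := by
  have h0 := one_sub_mul_ne_zero he.le hz
  have h1 : ‖e * z‖ < 1 := by rw [norm_mul, he, one_mul]; exact mem_unitDisk.1 hz
  set ζ := e * z
  have hpos := Complex.normSq_pos.2 h0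
  have h2 : ‖ζ‖ ^ 2 < 1 := by nlinarith [norm_nonneg ζ]
  rw [Complex.div_re, ← add_div, lt_div_iff₀ hpos]
  rw [← Complex.normSq_eq_norm_sq, Complex.normSq_apply] at h2
  rw [Complex.normSq_apply]
  simp
  nlinarith

/-- Shear criterion on the unit disk with respect to the half-plane map `e z / (1 - e z)`. -/
theorem injOn_and_convexInDirection_of_shear {γ : ℝ} {e : ℂ}
    (he : e = Complex.exp (γ * Complex.I)) {F : HarmonicPair}
    (hH : DifferentiableOn ℂ F.h unitDisk) (hG : DifferentiableOn ℂ F.g unitDisk)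
    (hJ : ∀ z ∈ unitDisk, ‖deriv F.g z‖ < ‖deriv F.h z‖)
    (hre : ∀ z ∈ unitDisk, (1 / (1 - e * z)).re - 1 / 2 ≤
      ((deriv F.h z - (starRingEnd ℂ) e ^ 2 * deriv F.g z) * (1 - e * z) ^ 2).re) :
    Set.InjOn F.eval unitDisk ∧ ConvexInDirection (-γ) (F.eval '' unitDisk) := by
  have hen : ‖e‖ = 1 := by rw [he, Complex.norm_exp_ofReal_mul_I]
  have hinv : e * (starRingEnd ℂ) e = 1 := by
    rw [Complex.mul_conj, Complex.normSq_eq_norm_sq, hen]; simp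
  have hexp : Complex.exp (((-γ : ℝ) : ℂ) * Complex.I) = (starRingEnd ℂ) e := by
    rw [he, ← Complex.exp_conj]
    simp
  set e' := (starRingEnd ℂ) e with he'
  have he'n : ‖e'‖ = 1 := by rw [he', RCLike.norm_conj, hen]
  -- The inverse of z ↦ ez/(1-ez).
  set q : ℂ → ℂ := fun w => e' * (w / (1 + w)) with hq
  have hw0 : ∀ w : ℂ, -(1 / 2) < w.re → 1 + w ≠ 0 := fun w hw h => by
    have := norm_lt_norm_one_add hw
    rw [h, norm_zero] at this
    exact absurd this (norm_nonneg _).not_gt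
  have hqmem : ∀ w : ℂ, -(1 / 2) < w.re → q w ∈ unitDisk := fun w hw => by
    rw [mem_unitDisk, hq]
    simp only [norm_mul, norm_div, he'n, one_mul]
    exact (div_lt_one (norm_pos_iff.2 (hw0 w hw))).2 (norm_lt_norm_one_add hw)
  have h1q : ∀ w : ℂ, -(1 / 2) < w.re → 1 - e * q w = (1 + w)⁻¹ := fun w hw => by
    have := hw0 w hw
    rw [hq]
    field_simp
    linear_combination (-w) * hinv
  have hqd : ∀ w : ℂ, -(1 / 2) < w.re → HasDerivAt q (e' * (1 - e * q w) ^ 2) w := fun w hw => by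
    have h0 := hw0 w hw
    have h := (((hasDerivAt_id w).div ((hasDerivAt_id w).const_add 1) h0)).const_mul e'
    rw [h1q w hw]
    refine h.congr_deriv ?_
    simp only [id]
    field_simp
    ring
  have hqinv : ∀ z ∈ unitDisk, q (e * z / (1 - e * z)) = z := fun z hz => by
    have h0 := one_sub_mul_ne_zero hen.le hz
    have h2 : 1 + e * z / (1 - e * z) = 1 / (1 - e * z) := by field_simp; ring
    simp only [hq]
    rw [h2]
    field_simp
    linear_combination z * hinv
  -- Multiplication by e turns the direction e^{-iγ} into the real axis. The co-analytic part
  -- acquires conj e, as e · conj G = conj(conj(e) · G).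
  set K : ℂ → ℂ := fun w => e * F.h (q w) with hK
  set L : ℂ → ℂ := fun w => e' * F.g (q w) with hL
  have hKd : ∀ w : ℂ, -(1 / 2) < w.re →
      HasDerivAt K (deriv F.h (q w) * (1 - e * q w) ^ 2) w := fun w hw => by
    have h := (((hH.differentiableAt
      (isOpen_unitDisk.mem_nhds (hqmem w hw))).hasDerivAt.comp w (hqd w hw))).const_mul e
    refine h.congr_deriv ?_
    linear_combination (deriv F.h (q w) * (1 - e * q w) ^ 2) * hinv
  have hLd : ∀ w : ℂ, -(1 / 2) < w.re →
      HasDerivAt L (e' ^ 2 * deriv F.g (q w) * (1 - e * q w) ^ 2) w := fun w hw => by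
    have h := (((hG.differentiableAt
      (isOpen_unitDisk.mem_nhds (hqmem w hw))).hasDerivAt.comp w (hqd w hw))).const_mul e'
    refine h.congr_deriv ?_
    ring
  have hE : ∀ w, K w + (starRingEnd ℂ) (L w) = e * F.eval (q w) := fun w => by
    simp [hK, hL, he', HarmonicPair.eval, mul_add]
  obtain ⟨hinj, hconv⟩ := injOn_and_isPreconnected_of_shear (m := -(1 / 2)) (K := K) (L := L)
    (fun w hw => (hKd w hw).differentiableAt.differentiableWithinAt)
    (fun w hw => (hLd w hw).differentiableAt.differentiableWithinAt)
    (fun w hw => by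
      have h0 : 1 - e * q w ≠ 0 := by rw [h1q w hw]; exact inv_ne_zero (hw0 w hw)
      have := norm_pos_iff.2 h0
      rw [(hKd w hw).deriv, (hLd w hw).deriv]
      simp only [norm_mul, norm_pow, he'n, one_pow, one_mul]
      have := hJ _ (hqmem w hw)
      gcongr)
    (fun w hw => by
      have := hre _ (hqmem w hw)
      rw [(hKd w hw).deriv, (hLd w hw).deriv, ← sub_mul]
      refine le_trans (le_of_eq ?_) this
      -- Since 1/(1 - e q(w)) = 1 + w, the bound in `hre` is Re w + 1/2.
      rw [h1q w hw]
      simp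
      ring)
  simp only [hE] at hinj hconv
  refine ⟨fun z₁ h₁ z₂ h₂ h => ?_, fun b => ?_⟩
  · have := hinj (neg_half_lt_re_div hen h₁) (neg_half_lt_re_div hen h₂)
      (by simp only [hqinv z₁ h₁, hqinv z₂ h₂, h])
    rw [← hqinv z₁ h₁, this, hqinv z₂ h₂]
  · have hset : F.eval '' unitDisk ∩ {w | ∃ t : ℝ, w = b + t * e'} =
        (fun ζ => e' * ζ) '' ((fun w => e * F.eval (q w)) '' {w | -(1 / 2) < w.re} ∩
          {w | w.im = (e * b).im}) := by
      ext ζ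
      constructor
      · rintro ⟨⟨z, hz, rfl⟩, t, ht⟩
        refine ⟨e * F.eval z, ⟨⟨_, neg_half_lt_re_div hen hz, by simp only [hqinv z hz]⟩, ?_⟩, ?_⟩
        · have : e * F.eval z = e * b + t := by
            rw [ht]
            linear_combination (t : ℂ) * hinv
          simp [this]
        · linear_combination F.eval z * hinv
      · rintro ⟨_, ⟨⟨w, hw, rfl⟩, him⟩, rfl⟩
        have hζ : e' * (e * F.eval (q w)) = F.eval (q w) := by
          linear_combination F.eval (q w) * hinv
        simp only [hζ]
        refine ⟨⟨_, hqmem w hw, rfl⟩, (e * F.eval (q w) - e * b).re, ?_⟩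
        have him' : (e * F.eval (q w) - e * b).im = 0 := by
          rw [Complex.sub_im, him, sub_self]
        have : (((e * F.eval (q w) - e * b).re : ℝ) : ℂ) = e * F.eval (q w) - e * b :=
          Complex.ext (by simp) (by rw [him']; simp)
        rw [this]
        linear_combination (b - F.eval (q w)) * hinv
    rw [hexp, hset]
    exact (hconv _).image _ (continuous_const.mul continuous_id).continuousOn

/-! ### Explicit slanted half-plane mappings and their convolution with `f₀`. -/

/-- Explicit derivatives of a slanted half-plane mapping with Möbius dilatation. -/
theorem IsSlantedHalfPlaneMap.deriv_eq {γ : ℝ} {a e e' c k : ℂ} {f : HarmonicPair}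
    (hf : IsSlantedHalfPlaneMap γ f) (ha : ‖a‖ < 1)
    (hω : ∀ z ∈ unitDisk, f.dilatation z = (z + a) / (1 + (starRingEnd ℂ) a * z))
    (he : e = Complex.exp (γ * Complex.I)) (he' : e' = (starRingEnd ℂ) e)
    (hc : c = 1 + e' ^ 2 * a) (hk : k = e' ^ 2 + (starRingEnd ℂ) a) {z : ℂ} (hz : z ∈ unitDisk) :
    c + k * z ≠ 0 ∧
    deriv f.h z = (1 + (starRingEnd ℂ) a * z) / ((1 - e * z) ^ 2 * (c + k * z)) ∧
    deriv f.g z = (z + a) / ((1 - e * z) ^ 2 * (c + k * z)) := by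
  have hen : ‖e‖ = 1 := by rw [he, Complex.norm_exp_ofReal_mul_I]
  have hinv : e * e' = 1 := by
    rw [he', Complex.mul_conj, Complex.normSq_eq_norm_sq, hen]; simp
  have hexp : Complex.exp (-(2 * γ * Complex.I)) = e' ^ 2 := by
    rw [he', he, ← Complex.exp_conj, ← Complex.exp_nat_mul]
    congr 1
    simp
    ring
  have h0 : (0 : ℂ) ∈ unitDisk := by simp [unitDisk]
  have hhd : ∀ z ∈ unitDisk, HasDerivAt f.h (deriv f.h z) z := fun z hz =>
    (hf.analytic_h.differentiableAt (isOpen_unitDisk.mem_nhds hz)).hasDerivAt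
  have hgd : ∀ z ∈ unitDisk, HasDerivAt f.g (deriv f.g z) z := fun z hz =>
    (hf.analytic_g.differentiableAt (isOpen_unitDisk.mem_nhds hz)).hasDerivAt
  set φ : ℂ → ℂ := fun z => e * f.h z + e' * f.g z with hφ
  have hφd : ∀ z ∈ unitDisk, HasDerivAt φ (e * deriv f.h z + e' * deriv f.g z) z := fun z hz =>
    ((hhd z hz).const_mul e).add ((hgd z hz).const_mul e')
  have hnorm := hf.normalized
  rw [hexp] at hnorm
  have hφeq : ∀ z ∈ unitDisk, φ z = e * z / (1 - e * z) := fun z hz => by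
    refine eq_div_of_mapsTo_halfPlane
      (fun z hz => (hφd z hz).differentiableAt.differentiableWithinAt)
      (by simp [hφ, hf.h_zero, hf.g_zero]) ?_ hen (fun z hz => ?_) hz
    · rw [(hφd 0 h0).deriv]
      linear_combination e * hnorm - e' * deriv f.g 0 * hinv
    · have h1 := hf.mapsTo hz
      simp only [slantedHalfPlane, Set.mem_ofPred_eq, ← he, HarmonicPair.eval] at h1
      have h2 : (φ z).re = (e * (f.h z + (starRingEnd ℂ) (f.g z))).re := by
        simp [hφ, he']
        ring
      rwa [h2]
  have hden := one_sub_mul_ne_zero hen.le hz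
  have hder : e * deriv f.h z + e' * deriv f.g z = e / (1 - e * z) ^ 2 := by
    have h1 : HasDerivAt (fun z : ℂ => e * z / (1 - e * z)) (e / (1 - e * z) ^ 2) z := by
      have h2 := (hasDerivAt_id z).const_mul e
      have h3 := h2.div (h2.const_sub 1) hden
      refine h3.congr_deriv ?_
      simp only [id]
      ring
    exact (hφd z hz).unique (h1.congr_of_eventuallyEq
      (eventuallyEq_of_mem (isOpen_unitDisk.mem_nhds hz) hφeq))
  have hh0 : deriv f.h z ≠ 0 := by
    intro h
    have := hf.jacobian_pos z hz
    rw [h, norm_zero] at this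
    nlinarith [sq_nonneg ‖deriv f.g z‖]
  have ha0 : 1 + (starRingEnd ℂ) a * z ≠ 0 :=
    one_add_mul_ne_zero (by rw [RCLike.norm_conj]; exact ha.le) hz
  have hg : deriv f.g z * (1 + (starRingEnd ℂ) a * z) = (z + a) * deriv f.h z := by
    have := hω z hz
    rw [HarmonicPair.dilatation, div_eq_div_iff hh0 ha0] at this
    exact this
  have hder' : (deriv f.h z + e' ^ 2 * deriv f.g z) * (1 - e * z) ^ 2 = 1 := by
    rw [eq_div_iff (pow_ne_zero 2 hden)] at hder
    linear_combination e' * hder + (1 - deriv f.h z * (1 - e * z) ^ 2) * hinv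
  -- Eliminating g' = ωh' from `hder'`; here c + kz = (1 + conj(a) z) + conj(e)²(z + a).
  have hmain : deriv f.h z * ((1 - e * z) ^ 2 * (c + k * z)) = 1 + (starRingEnd ℂ) a * z := by
    rw [hc, hk]
    linear_combination (1 + (starRingEnd ℂ) a * z) * hder' - e' ^ 2 * (1 - e * z) ^ 2 * hg
  have hck : c + k * z ≠ 0 := by
    intro h
    rw [h] at hmain
    simp only [mul_zero] at hmain
    exact ha0 hmain.symm
  have hD : (1 - e * z) ^ 2 * (c + k * z) ≠ 0 := mul_ne_zero (pow_ne_zero 2 hden) hck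
  refine ⟨hck, (eq_div_iff hD).2 hmain, (eq_div_iff hD).2 ?_⟩
  apply mul_right_cancel₀ ha0
  linear_combination (1 - e * z) ^ 2 * (c + k * z) * hg + (z + a) * hmain

/-- When p + r = 1, |p|² - |r|² = Re((p - r) conj(p + r)) = Re(p - r). It is applied to p =
h'(1-ez)² and r = conj(e)² g'(1-ez)². -/
theorem re_sub_nonneg_of_add_eq_one {p r : ℂ} (h : p + r = 1) (hrp : ‖r‖ ≤ ‖p‖) :
    0 ≤ (p - r).re := by
  have h1 : ‖r‖ ^ 2 ≤ ‖p‖ ^ 2 := by gcongr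
  rw [← Complex.normSq_eq_norm_sq, ← Complex.normSq_eq_norm_sq, Complex.normSq_apply,
    Complex.normSq_apply] at h1
  have h2 := congrArg Complex.re h
  have h3 := congrArg Complex.im h
  rw [Complex.add_re, Complex.one_re] at h2
  rw [Complex.add_im, Complex.one_im] at h3
  rw [eq_sub_of_add_eq' h2, eq_neg_of_add_eq_zero_right h3] at h1
  rw [Complex.sub_re]
  nlinarith

/-- The parameter inequalities, rewritten for `B = a e^{-iγ/2}`. -/
theorem half_angle_conditions {γ θ : ℝ} {a ε : ℂ} (hε : ε = Complex.exp ((γ / 2 : ℝ) * Complex.I))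
    (hθ : a = (‖a‖ : ℂ) * Complex.exp (θ * Complex.I))
    (hle : ‖a‖ ^ 2 * (Real.cos (θ - γ / 2) ^ 2 + 9 * Real.sin (θ - γ / 2) ^ 2) ≤ 1)
    (hne : ¬ (‖a‖ * Real.cos (θ - γ / 2) = -Real.cos (3 * γ / 2) ∧
      3 * ‖a‖ * Real.sin (θ - γ / 2) = -Real.sin (3 * γ / 2))) :
    ‖2 * (a * (starRingEnd ℂ) ε) - (starRingEnd ℂ) (a * (starRingEnd ℂ) ε)‖ ≤ 1 ∧
      2 * (a * (starRingEnd ℂ) ε) - (starRingEnd ℂ) (a * (starRingEnd ℂ) ε) ≠ -ε ^ 3 := by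
  have hB : a * (starRingEnd ℂ) ε = (‖a‖ : ℂ) * Complex.exp ((θ - γ / 2 : ℝ) * Complex.I) := by
    rw [hθ, hε, ← Complex.exp_conj, mul_assoc, ← Complex.exp_add, ← hθ]
    congr 2
    simp [map_ofNat]
    ring
  have hε3 : ε ^ 3 = Complex.exp ((3 * γ / 2 : ℝ) * Complex.I) := by
    rw [hε, ← Complex.exp_nat_mul]
    congr 1
    push_cast
    ring
  -- 2B - conj B = Re B + 3i Im B, which is the source of the factor 9 in `hle`.
  have hre : (2 * (a * (starRingEnd ℂ) ε) - (starRingEnd ℂ) (a * (starRingEnd ℂ) ε)).re =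
      ‖a‖ * Real.cos (θ - γ / 2) := by
    rw [hB]
    simp only [Complex.sub_re, Complex.conj_re, Complex.mul_re, Complex.ofReal_re, Complex.ofReal_im,
      Complex.exp_ofReal_mul_I_re, Complex.re_ofNat, Complex.im_ofNat]
    ring
  have him : (2 * (a * (starRingEnd ℂ) ε) - (starRingEnd ℂ) (a * (starRingEnd ℂ) ε)).im =
      3 * ‖a‖ * Real.sin (θ - γ / 2) := by
    rw [hB]
    simp only [Complex.sub_im, Complex.conj_im, Complex.mul_im, Complex.ofReal_re, Complex.ofReal_im,
      Complex.exp_ofReal_mul_I_im, Complex.re_ofNat, Complex.im_ofNat]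
    ring
  constructor
  · refine le_of_sq_le_sq ?_ zero_le_one
    rw [← Complex.normSq_eq_norm_sq, Complex.normSq_apply, hre, him]
    nlinarith
  · intro h
    apply hne
    rw [← hre, ← him, h, hε3, Complex.neg_re, Complex.neg_im, Complex.exp_ofReal_mul_I_re,
      Complex.exp_ofReal_mul_I_im]
    exact ⟨rfl, rfl⟩

/-- Derivatives of the two parts of the convolution with `f₀`. -/
theorem hasDerivAt_convolution_f₀ {f : HarmonicPair} (hf : f.IsUnivalent) {z : ℂ}
    (hz : z ∈ unitDisk) :
    HasDerivAt (convolution f₀ f).h ((2 * deriv f.h z + z * deriv (deriv f.h) z) / 2) z ∧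
      HasDerivAt (convolution f₀ f).g (-(z * deriv (deriv f.g) z) / 2) z := by
  have hn := isOpen_unitDisk.mem_nhds hz
  have h1 := (hf.analytic_h.differentiableAt hn).hasDerivAt
  have h2 := ((hf.analytic_h.deriv isOpen_unitDisk).differentiableAt hn).hasDerivAt
  have g1 := (hf.analytic_g.differentiableAt hn).hasDerivAt
  have g2 := ((hf.analytic_g.deriv isOpen_unitDisk).differentiableAt hn).hasDerivAt
  constructor
  · have h := (h1.add ((hasDerivAt_id z).mul h2)).div_const 2
    refine (h.congr_of_eventuallyEq (eventuallyEq_of_mem hn fun w hw =>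
      hadamard_f₀_h hf.analytic_h hf.h_zero hw)).congr_deriv ?_
    simp only [id]
    ring
  · have h := (g1.sub ((hasDerivAt_id z).mul g2)).div_const 2
    refine (h.congr_of_eventuallyEq (eventuallyEq_of_mem hn fun w hw =>
      hadamard_f₀_g hf.analytic_g hf.g_zero hw)).congr_deriv ?_
    simp only [id]
    ring

/-- Local univalence of the convolution and the lower bound needed for shearing. -/
theorem IsSlantedHalfPlaneMap.convolution_deriv {γ θ : ℝ} {a e : ℂ} {f : HarmonicPair}
    (hf : IsSlantedHalfPlaneMap γ f) (ha : ‖a‖ < 1)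
    (hθ : a = (‖a‖ : ℂ) * Complex.exp (θ * Complex.I))
    (hω : ∀ z ∈ unitDisk, f.dilatation z = (z + a) / (1 + (starRingEnd ℂ) a * z))
    (hle : ‖a‖ ^ 2 * (Real.cos (θ - γ / 2) ^ 2 + 9 * Real.sin (θ - γ / 2) ^ 2) ≤ 1)
    (hne : ¬ (‖a‖ * Real.cos (θ - γ / 2) = -Real.cos (3 * γ / 2) ∧
      3 * ‖a‖ * Real.sin (θ - γ / 2) = -Real.sin (3 * γ / 2)))
    (he : e = Complex.exp (γ * Complex.I)) {z : ℂ} (hz : z ∈ unitDisk) :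
    ‖deriv (convolution f₀ f).g z‖ < ‖deriv (convolution f₀ f).h z‖ ∧
    (1 / (1 - e * z)).re - 1 / 2 ≤ ((deriv (convolution f₀ f).h z -
      (starRingEnd ℂ) e ^ 2 * deriv (convolution f₀ f).g z) * (1 - e * z) ^ 2).re := by
  have hen : ‖e‖ = 1 := by rw [he, Complex.norm_exp_ofReal_mul_I]
  set c := 1 + (starRingEnd ℂ) e ^ 2 * a with hc
  set k := (starRingEnd ℂ) e ^ 2 + (starRingEnd ℂ) a with hk
  have hform := fun w (hw : w ∈ unitDisk) => hf.deriv_eq ha hω he rfl hc hk hw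
  obtain ⟨hck, hh, hg⟩ := hform z hz
  have hn := isOpen_unitDisk.mem_nhds hz
  have hden := one_sub_mul_ne_zero hen.le hz
  set T := -2 * e * (c + k * z) + k * (1 - e * z) with hT
  have hDd : HasDerivAt (fun z : ℂ => (1 - e * z) ^ 2 * (c + k * z)) ((1 - e * z) * T) z := by
    have h := ((((hasDerivAt_id z).const_mul e).const_sub 1).pow 2).mul
      (((hasDerivAt_id z).const_mul k).const_add c)
    refine h.congr_deriv ?_
    simp [hT]
    ring
  have hD : (1 - e * z) ^ 2 * (c + k * z) ≠ 0 := mul_ne_zero (pow_ne_zero 2 hden) hck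
  have hh2 : deriv (deriv f.h) z = ((starRingEnd ℂ) a * (1 - e * z) * (c + k * z) -
      (1 + (starRingEnd ℂ) a * z) * T) / ((1 - e * z) ^ 3 * (c + k * z) ^ 2) := by
    rw [(eventuallyEq_of_mem hn fun w hw => (hform w hw).2.1).deriv_eq]
    have h := (((hasDerivAt_id z).const_mul ((starRingEnd ℂ) a)).const_add 1).div hDd hD
    refine (h.congr_deriv ?_).deriv
    simp only [id]
    field_simp
  have hg2 : deriv (deriv f.g) z = ((1 - e * z) * (c + k * z) - (z + a) * T) /
      ((1 - e * z) ^ 3 * (c + k * z) ^ 2) := by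
    rw [(eventuallyEq_of_mem hn fun w hw => (hform w hw).2.2).deriv_eq]
    have h := ((hasDerivAt_id z).add_const a).div hDd hD
    refine (h.congr_deriv ?_).deriv
    simp only [id]
    field_simp
  obtain ⟨hH, hG⟩ := hasDerivAt_convolution_f₀ hf.toIsUnivalent hz
  rw [hH.deriv, hG.deriv]
  constructor
  · set ε := Complex.exp ((γ / 2 : ℝ) * Complex.I) with hε
    have hεn : ‖ε‖ = 1 := Complex.norm_exp_ofReal_mul_I _
    have hinv : ε * (starRingEnd ℂ) ε = 1 := by
      rw [Complex.mul_conj, Complex.normSq_eq_norm_sq, hεn]; simp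
    have heε : e = ε ^ 2 := by
      rw [he, hε, ← Complex.exp_nat_mul]
      congr 1
      push_cast
      ring
    obtain ⟨hZ, hZne⟩ := half_angle_conditions hε hθ hle hne
    have hlt := norm_numerator_lt (a := a) (c := c) (k := k) (z := z) hεn
      (by rw [norm_mul, RCLike.norm_conj, hεn, mul_one]; exact ha)
      hZ hZne (mem_unitDisk.1 hz) heε (by linear_combination (-a) * hinv)
      (by rw [hc, heε, map_pow]; ring) (by rw [hk, heε, map_pow]; ring)
    have e1 : -(z * deriv (deriv f.g) z) / 2 =
        -(z * ((1 - e * z) * (c + k * z) - (z + a) * T)) /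
          (2 * ((1 - e * z) ^ 3 * (c + k * z) ^ 2)) := by
      rw [hg2]
      field_simp
    have e2 : (2 * deriv f.h z + z * deriv (deriv f.h) z) / 2 =
        ((2 + 3 * (starRingEnd ℂ) a * z) * (1 - e * z) * (c + k * z) -
          z * (1 + (starRingEnd ℂ) a * z) * T) / (2 * ((1 - e * z) ^ 3 * (c + k * z) ^ 2)) := by
      rw [hh2, hh]
      field_simp
      ring
    have hpos : 0 < ‖2 * ((1 - e * z) ^ 3 * (c + k * z) ^ 2)‖ :=
      norm_pos_iff.2 (mul_ne_zero two_ne_zero (mul_ne_zero (pow_ne_zero 3 hden)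
        (pow_ne_zero 2 hck)))
    rw [e1, e2, norm_div, norm_div, norm_neg]
    gcongr
  · have hck' : c + k * z = (1 + (starRingEnd ℂ) a * z) +
      (starRingEnd ℂ) e ^ 2 * (z + a) := by rw [hc, hk]; ring
    have hsum : deriv f.h z * (1 - e * z) ^ 2 +
        (starRingEnd ℂ) e ^ 2 * deriv f.g z * (1 - e * z) ^ 2 = 1 := by
      rw [hh, hg, show (1 + (starRingEnd ℂ) a * z) / ((1 - e * z) ^ 2 * (c + k * z)) *
        (1 - e * z) ^ 2 + (starRingEnd ℂ) e ^ 2 * ((z + a) / ((1 - e * z) ^ 2 * (c + k * z))) *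
        (1 - e * z) ^ 2 = (1 - e * z) ^ 2 * (1 + (starRingEnd ℂ) a * z +
          (starRingEnd ℂ) e ^ 2 * (z + a)) / ((1 - e * z) ^ 2 * (c + k * z)) by ring, ← hck',
        div_self hD]
    -- This is the derivative of h' + conj(e)² g' = (1-ez)⁻², checked here on the explicit formulas.
    have hsum2 : deriv (deriv f.h) z + (starRingEnd ℂ) e ^ 2 * deriv (deriv f.g) z =
        2 * e / (1 - e * z) ^ 3 := by
      have hnum : ((starRingEnd ℂ) a * (1 - e * z) * (c + k * z) -
          (1 + (starRingEnd ℂ) a * z) * T) + (starRingEnd ℂ) e ^ 2 *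
          ((1 - e * z) * (c + k * z) - (z + a) * T) = 2 * e * (c + k * z) ^ 2 := by
        rw [hT]
        linear_combination (2 * e * (c + k * z) - k * (1 - e * z)) * (-hck') -
          (1 - e * z) * (c + k * z) * hk
      rw [hh2, hg2, ← mul_div_assoc, ← add_div, hnum]
      field_simp
    have hpole : z * (2 * e / (1 - e * z) ^ 3) * (1 - e * z) ^ 2 / 2 = 1 / (1 - e * z) - 1 := by
      have hez : e * z = 1 - (1 - e * z) := by ring
      generalize 1 - e * z = Q at hden hez
      field_simp
      linear_combination hez
    have hJ := hf.jacobian_pos z hz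
    have hle' : ‖deriv f.g z‖ ≤ ‖deriv f.h z‖ :=
      le_of_sq_le_sq (by linarith) (norm_nonneg _)
    have hp := re_sub_nonneg_of_add_eq_one hsum (by
      simp only [norm_mul, norm_pow, RCLike.norm_conj, hen, one_pow, one_mul]
      gcongr)
    -- The first-order terms give (p - r)/2 + 1/2, the second-order terms ez/(1-ez) = 1/(1-ez) - 1.
    -- As Re(p - r) ≥ 0, the claimed bound remains.
    have key : ((2 * deriv f.h z + z * deriv (deriv f.h) z) / 2 -
        (starRingEnd ℂ) e ^ 2 * (-(z * deriv (deriv f.g) z) / 2)) * (1 - e * z) ^ 2 =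
        (deriv f.h z * (1 - e * z) ^ 2 -
          (starRingEnd ℂ) e ^ 2 * deriv f.g z * (1 - e * z) ^ 2) / 2 +
          (1 / (1 - e * z) - 1 / 2) := by
      linear_combination z / 2 * (1 - e * z) ^ 2 * hsum2 + hsum / 2 + hpole
    rw [key, Complex.add_re, Complex.sub_re, Complex.div_ofNat_re, Complex.div_ofNat_re,
      Complex.one_re]
    linarith

theorem HarmonicPair.IsUnivalent.memSH0_scale {f : HarmonicPair} (hf : f.IsUnivalent) {c : ℂ}
    (hc : c * deriv f.h 0 = 1) (hg : deriv f.g 0 = 0) : (HarmonicPair.scale c f).MemSH0 := by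
  have hc0 : c ≠ 0 := left_ne_zero_of_mul_eq_one hc
  have hh' : ∀ z ∈ unitDisk, deriv (HarmonicPair.scale c f).h z = c * deriv f.h z := fun z hz =>
    deriv_const_mul c (hf.analytic_h.differentiableAt (isOpen_unitDisk.mem_nhds hz))
  have hg' : ∀ z ∈ unitDisk,
      deriv (HarmonicPair.scale c f).g z = (starRingEnd ℂ) c * deriv f.g z := fun z hz =>
    deriv_const_mul _ (hf.analytic_g.differentiableAt (isOpen_unitDisk.mem_nhds hz))
  have h0 : (0 : ℂ) ∈ unitDisk := by simp [unitDisk]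
  refine
    { analytic_h := hf.analytic_h.const_mul c
      analytic_g := hf.analytic_g.const_mul _
      h_zero := by simp [HarmonicPair.scale, hf.h_zero]
      g_zero := by simp [HarmonicPair.scale, hf.g_zero]
      jacobian_pos := fun z hz => ?_
      injOn := fun z₁ h₁ z₂ h₂ h => ?_
      deriv_h_zero := by rw [hh' 0 h0, hc]
      deriv_g_zero := by rw [hg' 0 h0, hg, mul_zero] }
  · rw [hh' z hz, hg' z hz, norm_mul, norm_mul, RCLike.norm_conj, mul_pow, mul_pow, ← mul_sub]
    exact mul_pos (pow_pos (norm_pos_iff.2 hc0) 2) (hf.jacobian_pos z hz)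
  · rw [HarmonicPair.eval_scale, HarmonicPair.eval_scale] at h
    exact hf.injOn h₁ h₂ (mul_left_cancel₀ hc0 h)

end HarmonicConvolution

theorem mainTheorem2 (γ θ : ℝ) (a : ℂ) (f : HarmonicConvolution.HarmonicPair)
    (hf : HarmonicConvolution.IsSlantedHalfPlaneMap γ f)
    (ha : ‖a‖ < 1)
    (hθ : a = (‖a‖ : ℂ) * Complex.exp (θ * Complex.I))
    (hω : ∀ z ∈ HarmonicConvolution.unitDisk,
      f.dilatation z = (z + a) / (1 + (starRingEnd ℂ) a * z))
    (hle : ‖a‖ ^ 2 * (Real.cos (θ - γ / 2) ^ 2 + 9 * Real.sin (θ - γ / 2) ^ 2) ≤ 1)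
    (hne : ¬ (‖a‖ * Real.cos (θ - γ / 2) = -Real.cos (3 * γ / 2) ∧
      3 * ‖a‖ * Real.sin (θ - γ / 2) = -Real.sin (3 * γ / 2))) :
    (HarmonicConvolution.convolution HarmonicConvolution.f₀ f).IsUnivalent ∧
    (HarmonicConvolution.HarmonicPair.scale
      (1 + a * Complex.exp (-(2 * γ * Complex.I)))
      (HarmonicConvolution.convolution HarmonicConvolution.f₀ f)).MemSH0 ∧
    (f.MemSH0 → (HarmonicConvolution.convolution HarmonicConvolution.f₀ f).MemSH0) ∧
    HarmonicConvolution.ConvexInDirection (-γ)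
      ((HarmonicConvolution.convolution HarmonicConvolution.f₀ f).eval ''
        HarmonicConvolution.unitDisk) := by
  open HarmonicConvolution in
  have h0 : (0 : ℂ) ∈ unitDisk := by simp [unitDisk]
  have hd := fun z (hz : z ∈ unitDisk) => hasDerivAt_convolution_f₀ hf.toIsUnivalent hz
  have hH : DifferentiableOn ℂ (convolution f₀ f).h unitDisk := fun z hz =>
    (hd z hz).1.differentiableAt.differentiableWithinAt
  have hG : DifferentiableOn ℂ (convolution f₀ f).g unitDisk := fun z hz =>
    (hd z hz).2.differentiableAt.differentiableWithinAt
  have hcd := fun z (hz : z ∈ unitDisk) => hf.convolution_deriv ha hθ hω hle hne rfl hz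
  obtain ⟨hinj, hconv⟩ := injOn_and_convexInDirection_of_shear rfl hH hG
    (fun z hz => (hcd z hz).1) (fun z hz => (hcd z hz).2)
  have hH0 : deriv (convolution f₀ f).h 0 = deriv f.h 0 := by rw [(hd 0 h0).1.deriv]; ring
  have hG0 : deriv (convolution f₀ f).g 0 = 0 := by rw [(hd 0 h0).2.deriv]; ring
  have huniv : (convolution f₀ f).IsUnivalent :=
    { analytic_h := hH
      analytic_g := hG
      h_zero := by
        change hadamard f₀.h f.h 0 = 0
        rw [hadamard_f₀_h hf.analytic_h hf.h_zero h0, hf.h_zero]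
        ring
      g_zero := by
        change hadamard f₀.g f.g 0 = 0
        rw [hadamard_f₀_g hf.analytic_g hf.g_zero h0, hf.g_zero]
        ring
      jacobian_pos := fun z hz => by
        have := (hcd z hz).1
        have : ‖deriv (convolution f₀ f).g z‖ ^ 2 < ‖deriv (convolution f₀ f).h z‖ ^ 2 := by
          gcongr
        linarith
      injOn := hinj }
  refine ⟨huniv, huniv.memSH0_scale ?_ hG0, fun h => ?_, hconv⟩
  · have hh0 : deriv f.h 0 ≠ 0 := by
      intro h
      have := hf.jacobian_pos 0 h0
      rw [h, norm_zero] at this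
      nlinarith [sq_nonneg ‖deriv f.g 0‖]
    -- At 0 the dilatation gives g'(0) = a h'(0), so the normalization reads (1 + a e^{-2iγ}) h'(0)
    -- = 1.
    have h1 := hω 0 h0
    rw [HarmonicPair.dilatation, div_eq_iff hh0, zero_add, mul_zero, add_zero, div_one] at h1
    have h2 := hf.normalized
    rw [h1] at h2
    rw [hH0]
    linear_combination h2
  · exact { toIsUnivalent := huniv
            deriv_h_zero := hH0.trans h.deriv_h_zero
            deriv_g_zero := hG0 }
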